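/- Let $N$ users each hold a local dataset of $D$ records, $D_i=(d_{i,1},\dots,d_{i,D})$, let $L(\theta,d)$ be a loss with model parameter $\theta\in\mathbb R^K$, differentiable at the current parameter $\theta$ for every record $d$, and let $C>0$, $B\ge 1$ and $\sigma\in\mathbb R$. Write $g_{i,j}=\mathrm{clip}(\nabla_\theta L(\theta,d_{i,j}),C)$ with $\mathrm{clip}(x,C)=\frac{Cx}{\max(\|x\|_2,C)}$, and $\Sigma_i=\frac1{BD}\sum_{j=1}^D g_{i,j}g_{i,j}^T$. With a spectral decomposition $\Sigma_i=U_i\Lambda_iU_i^T$, let $\Sigma_{i,+}=U_i\Lambda_{i,+}U_i^T$, where $\Lambda_{i,+}$ is obtained from $\Lambda_i$ by replacing each eigenvalue $\lambda$ by $\max(\lambda,\sigma^2)$ (water filling). In one training round user $i$ draws Gaussian sampling weights $w_i\sim N(\frac1D\mathbf 1,\frac1{BD}I_D)$ and water-filling noise $n_i\sim N(0,\Sigma_{i,+}-\Sigma_i)$, all independent (also across users), and only the aggregated update $x=\sum_{i=1}^N\big(\sum_{j=1}^D w_{i,j}g_{i,j}+n_i\big)$ is released. For $\alpha>1$ let $D_\alpha(P\|Q)=\frac1{\alpha-1}\log\mathbb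 E_{x\sim Q}\big[(\tfrac{dP}{dQ}(x))^\alpha\big]$ (and $+\infty$ if $P\not\ll Q$) be the Rényi divergence. For a fixed user $i$, call two collections of local datasets adjacent if they differ in at most one record of $D_i$ and agree for all other users. A mechanism $\mathcal M$, regarded as a map from inputs to output distributions, is $(\alpha,\epsilon)$-RDP if $D_\alpha(\mathcal M(X)\|\mathcal M(X'))\le\epsilon$ for all adjacent $X,X'$, and $(\epsilon,\delta)$-DP if $\mathcal M(X)(S)\le e^{\epsilon}\mathcal M(X')(S)+\delta$ for all adjacent $X,X'$ and all measurable $S$. Then for every $\alpha\in\big(1,\frac{N\sigma^2D}{2C^2}\big)$ and every user $i$, the aggregated update $x$ is $(\alpha,\epsilon)$-RDP with respect to user $i$'s local dataset, where $$\epsilon=\Big(\frac{2\alpha C^2}{D^2}+\frac{2\alpha C^2}{(\alpha-1)BD}\Big)\frac{1}{N\sigma^2-\frac{2\alpha C^2}{BD}},$$ and, for every $\delta>0$, it is $\big(\epsilon+\frac{\log(1/\delta)}{\alpha-1},\delta\big)$-DP with respect to user $i$'s local dataset. -/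

import Mathlib

open MeasureTheory ProbabilityTheory

noncomputable section

namespace SecureAgg

/-! ### Rényi divergence and differential privacy -/

open Classical in
/-- The Rényi divergence of order `α` (`0 < α`, `α ≠ 1`) of two probability measures,
`(α - 1)⁻¹ * log 𝔼_{x ∼ Q} [(dP/dQ)(x) ^ α]`, with values in the extended reals; for `α > 1` it is
`⊤` when `P` is not absolutely continuous with respect to `Q`. -/
def renyiDiv {Y : Type*} [MeasurableSpace Y] (α : ℝ) (P Q : Measure Y) : EReal :=
  if 1 < α ∧ ¬ P ≪ Q then ⊤
  else (((α - 1)⁻¹ : ℝ) : EReal) * ENNReal.log (∫⁻ x, (P.rnDeriv Q x) ^ α ∂Q)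

/-- A randomized mechanism `M` (mapping an input to the law of its output) is `(α, ε)`-Rényi
differentially private for the adjacency relation `adj`. -/
def IsRDP {X Y : Type*} [MeasurableSpace Y] (adj : X → X → Prop) (M : X → Measure Y)
    (α ε : ℝ) : Prop :=
  ∀ x x', adj x x' → renyiDiv α (M x) (M x') ≤ (ε : EReal)

/-- A randomized mechanism `M` is `(ε, δ)`-differentially private for the adjacency relation
`adj`. -/
def IsDP {X Y : Type*} [MeasurableSpace Y] (adj : X → X → Prop) (M : X → Measure Y)
    (ε δ : ℝ) : Prop :=
  ∀ x x', adj x x' → ∀ S : Set Y, MeasurableSet S →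
    M x S ≤ ENNReal.ofReal (Real.exp ε) * M x' S + ENNReal.ofReal δ

/-- Record-level adjacency for user `i`: the datasets of all other users agree, and the datasets
of user `i` agree except possibly at one record. Here `X k j` is the `j`-th record of user `k`. -/
def AdjUser {N D : ℕ} {𝒟 : Type*} (i : Fin N) (X X' : Fin N → Fin D → 𝒟) : Prop :=
  (∀ k, k ≠ i → X k = X' k) ∧ ∃ j, ∀ l, l ≠ j → X i l = X' i l

/-! ### Gaussian gradient sampling with water-filling noise addition -/

/-- Clipping to norm at most `C`: `clip (x, C) = C x / max (‖x‖₂, C)`. -/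
def clip {K : ℕ} (C : ℝ) (x : EuclideanSpace ℝ (Fin K)) : EuclideanSpace ℝ (Fin K) :=
  (C / max ‖x‖ C) • x

/-- The clipped gradient of the loss at the model parameters `θ` and the data point `d`. -/
def clippedGrad {K : ℕ} {𝒟 : Type*} (L : EuclideanSpace ℝ (Fin K) → 𝒟 → ℝ)
    (θ : EuclideanSpace ℝ (Fin K)) (C : ℝ) (d : 𝒟) : EuclideanSpace ℝ (Fin K) :=
  clip C (gradient (fun θ' => L θ' d) θ)

/-- The covariance matrix of the gradient noise, `(B D)⁻¹ ∑ j, g_j g_jᵀ`. -/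
def gradCov {K D : ℕ} (B : ℝ) (g : Fin D → EuclideanSpace ℝ (Fin K)) :
    Matrix (Fin K) (Fin K) ℝ :=
  (1 / (B * D)) • ∑ j, Matrix.vecMulVec (g j).ofLp (g j).ofLp

theorem gradCov_isHermitian {K D : ℕ} (B : ℝ) (g : Fin D → EuclideanSpace ℝ (Fin K)) :
    (gradCov B g).IsHermitian := by
  ext a b
  simp [gradCov, Matrix.sum_apply, Matrix.vecMulVec_apply, mul_comm]

/-- Water filling at level `s`: in a spectral decomposition `A = U Λ Uᵀ` every eigenvalue `λ` is
replaced by `max λ s`. -/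
def waterFill {K : ℕ} {A : Matrix (Fin K) (Fin K) ℝ} (hA : A.IsHermitian) (s : ℝ) :
    Matrix (Fin K) (Fin K) ℝ :=
  (hA.eigenvectorUnitary : Matrix (Fin K) (Fin K) ℝ) *
    Matrix.diagonal (fun k => max (hA.eigenvalues k) s) *
    (hA.eigenvectorUnitary : Matrix (Fin K) (Fin K) ℝ).transpose

/-- The covariance matrix `Σ₊ - Σ` of the additional noise, where `Σ` is the covariance matrix of
the gradient noise and `Σ₊` is obtained from it by water filling at level `σ²`. -/
def wfNoiseCov {K D : ℕ} (B σ : ℝ) (g : Fin D → EuclideanSpace ℝ (Fin K)) :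
    Matrix (Fin K) (Fin K) ℝ :=
  waterFill (gradCov_isHermitian B g) (σ ^ 2) - gradCov B g

/-- The law `N(1/D, I_D / (B D))` of the Gaussian sampling weights of one user. -/
def weightLaw (D : ℕ) (B : ℝ) : Measure (EuclideanSpace ℝ (Fin D)) :=
  multivariateGaussian (WithLp.toLp 2 fun _ => 1 / (D : ℝ))
    ((1 / (B * D)) • (1 : Matrix (Fin D) (Fin D) ℝ))

/-- The law of the aggregated model update `∑ k, (∑ j, w_{k,j} g_{k,j} + n_k)`, given the
clipped gradients `g k j` of all users `k`, where the sampling weights `w_k ∼ N(1/D, I_D / (B D))`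
and the water-filling noises `n_k ∼ N(0, Σ_{k,+} - Σ_k)` of all users are independent. -/
def aggregateLaw {N D K : ℕ} (B σ : ℝ) (g : Fin N → Fin D → EuclideanSpace ℝ (Fin K)) :
    Measure (EuclideanSpace ℝ (Fin K)) :=
  (Measure.pi fun k => (weightLaw D B).prod (multivariateGaussian 0 (wfNoiseCov B σ (g k)))).map
    fun ω => ∑ k, ((∑ j, (ω k).1 j • g k j) + (ω k).2)

/-- One training round at model parameters `θ` as a randomized mechanism: the local datasets of
all users are mapped to the law of the aggregated model update. -/
def wfMechanism {N D K : ℕ} {𝒟 : Type*} (L : EuclideanSpace ℝ (Fin K) → 𝒟 → ℝ)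
    (θ : EuclideanSpace ℝ (Fin K)) (C B σ : ℝ) (X : Fin N → Fin D → 𝒟) :
    Measure (EuclideanSpace ℝ (Fin K)) :=
  aggregateLaw B σ fun k j => clippedGrad L θ C (X k j)

end SecureAgg

end

/-!
The aggregated update is Gaussian. User `k` contributes mean `(1/D) ∑ j, g_{k,j}` and covariance
`Σ_k + (Σ_{k,+} - Σ_k) = Σ_{k,+}`, which is at least `σ²` as a quadratic form, so the total
covariance `S` satisfies `S ≥ m = N σ²`. These facts are read off from characteristic functions
(`charFun_aggregateLaw`, `le_dotProduct_aggregateCov_mulVec`).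

Changing one record of user `i` moves the mean by at most `2C/D`. It changes `Σ_i` by `(g'g'ᵀ -
ggᵀ)/(BD)`, of Frobenius norm at most `√2 c` with `c = C²/(BD)`. Water filling `λ ↦ max(λ, σ²)` is
nonexpansive in the Frobenius norm (`sum_sq_waterFill_sub_le`; it is not so in the operator norm),
so `S' - S` obeys the same bound.

Write `S = R Rᵀ` and `S' = R (1 + diag e) Rᵀ` (`exists_simultaneous_diagonalization`); then `∑
e_k² ≤ 2 c² / m²`, and the difference `Δ` of the means satisfies `|R⁻¹ Δ|² ≤ (2C/D)² / m`. Both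
laws are images under `R` of products of one-dimensional Gaussian laws, so the moment
`𝔼_Q[(dP/dQ)^α]` factorises. Completing the square gives the `k`-th factor as the exponential of
`α (α - 1) d_k² / (2 s_k) + (α log (1 + e_k) - log s_k) / 2`, where `s_k = 1 + α e_k` and `d = R⁻¹
Δ` (`lintegral_gaussianPDF_div_rpow`). Here `s_k ≥ (m - 2αc)/m`, and the logarithms contribute at
most `α² e_k² / (2 s_k)`, which is of second order in `e`; this is why a Frobenius bound suffices.
Summing over `k` yields the moment bound `aggregateLaw_moment_le`.

The moment bound is a bound on the Rényi divergence (`renyiDiv_le`), and it yields approximate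
differential privacy by a Markov-type argument (`measure_le_of_lintegral_rnDeriv_rpow_le`).
-/

namespace SecureAgg

open Matrix

/-! ### Symmetric matrices in the Frobenius norm -/

section Matrices

variable {n : Type*} [Fintype n]

theorem sum_sq_eq_trace (A : Matrix n n ℝ) : ∑ i, ∑ j, A i j ^ 2 = (Aᵀ * A).trace := by
  simp only [trace, diag_apply, mul_apply, transpose_apply]
  rw [Finset.sum_comm]
  simp [sq]

variable [DecidableEq n]

theorem sum_sq_mul_left {U : Matrix n n ℝ} (hU : Uᵀ * U = 1) (A : Matrix n n ℝ) :
    ∑ i, ∑ j, (U * A) i j ^ 2 = ∑ i, ∑ j, A i j ^ 2 := by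
  rw [sum_sq_eq_trace, sum_sq_eq_trace, transpose_mul, Matrix.mul_assoc, ← Matrix.mul_assoc Uᵀ, hU,
    Matrix.one_mul]

theorem sum_sq_mul_right {V : Matrix n n ℝ} (hV : V * Vᵀ = 1) (A : Matrix n n ℝ) :
    ∑ i, ∑ j, (A * V) i j ^ 2 = ∑ i, ∑ j, A i j ^ 2 := by
  rw [sum_sq_eq_trace, sum_sq_eq_trace, transpose_mul, Matrix.mul_assoc, trace_mul_comm,
    Matrix.mul_assoc, Matrix.mul_assoc, hV, Matrix.mul_one]

theorem sum_sq_conj {U V : Matrix n n ℝ} (hU : U * Uᵀ = 1) (hV : V * Vᵀ = 1)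
    (A : Matrix n n ℝ) :
    ∑ i, ∑ j, (Uᵀ * A * V) i j ^ 2 = ∑ i, ∑ j, A i j ^ 2 := by
  rw [sum_sq_mul_right hV, sum_sq_mul_left (by simpa using hU)]

theorem sum_mulVec_sq {U : Matrix n n ℝ} (hU : Uᵀ * U = 1) (v : n → ℝ) :
    ∑ i, (U *ᵥ v) i ^ 2 = ∑ i, v i ^ 2 := by
  have h : (U *ᵥ v) ⬝ᵥ (U *ᵥ v) = v ⬝ᵥ v := by
    rw [dotProduct_mulVec, vecMul_mulVec, hU, vecMul_one]
  simpa [dotProduct, ← sq] using h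

/-- Replacing the spectra `a`, `b` of two symmetric matrices by `a'`, `b'` whose mutual distances
are no larger does not increase the Frobenius distance of the matrices: in the mixed eigenbasis
the difference has entries `(a k - b l) ⟨u_k, v_l⟩`. -/
theorem sum_sq_sub_le_of_spectral {U V : Matrix n n ℝ} (hU : U * Uᵀ = 1) (hV : V * Vᵀ = 1)
    (a b a' b' : n → ℝ) (h : ∀ k l, |a' k - b' l| ≤ |a k - b l|) :
    ∑ i, ∑ j, (U * diagonal a' * Uᵀ - V * diagonal b' * Vᵀ) i j ^ 2 ≤
      ∑ i, ∑ j, (U * diagonal a * Uᵀ - V * diagonal b * Vᵀ) i j ^ 2 := by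
  have hU' : Uᵀ * U = 1 := mul_eq_one_comm.mp hU
  have hV' : Vᵀ * V = 1 := mul_eq_one_comm.mp hV
  have key (a b : n → ℝ) (k l : n) :
      (Uᵀ * (U * diagonal a * Uᵀ - V * diagonal b * Vᵀ) * V) k l =
        (a k - b l) * (Uᵀ * V) k l := by
    have : Uᵀ * (U * diagonal a * Uᵀ - V * diagonal b * Vᵀ) * V =
        diagonal a * (Uᵀ * V) - Uᵀ * V * diagonal b := by
      calc _ = (Uᵀ * U) * diagonal a * (Uᵀ * V) - Uᵀ * V * diagonal b * (Vᵀ * V) := by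
            simp only [Matrix.mul_sub, Matrix.sub_mul, Matrix.mul_assoc]
        _ = _ := by rw [hU', hV', Matrix.one_mul, Matrix.mul_one]
    rw [this, Matrix.sub_apply, diagonal_mul, mul_diagonal]
    ring
  rw [← sum_sq_conj hU hV, ← sum_sq_conj hU hV (U * diagonal a * Uᵀ - _)]
  refine Finset.sum_le_sum fun k _ => Finset.sum_le_sum fun l _ => ?_
  rw [key, key, mul_pow, mul_pow]
  exact mul_le_mul_of_nonneg_right (sq_le_sq.2 (h k l)) (sq_nonneg _)

theorem eq_mul_diagonal_mul_transpose {A : Matrix n n ℝ} (hA : A.IsHermitian) :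
    A = (hA.eigenvectorUnitary : Matrix n n ℝ) * diagonal hA.eigenvalues *
      (hA.eigenvectorUnitary : Matrix n n ℝ)ᵀ := by
  conv_lhs => rw [hA.spectral_theorem, Unitary.conjStarAlgAut_apply]
  rfl

theorem eigenvectorUnitary_mul_transpose {A : Matrix n n ℝ} (hA : A.IsHermitian) :
    (hA.eigenvectorUnitary : Matrix n n ℝ) * (hA.eigenvectorUnitary : Matrix n n ℝ)ᵀ = 1 :=
  Unitary.coe_mul_star_self hA.eigenvectorUnitary

theorem dotProduct_conj_diagonal_mulVec (U : Matrix n n ℝ) (a v : n → ℝ) :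
    v ⬝ᵥ (U * diagonal a * Uᵀ) *ᵥ v = ∑ k, a k * (Uᵀ *ᵥ v) k ^ 2 := by
  rw [Matrix.mul_assoc, ← mulVec_mulVec, dotProduct_mulVec, ← mulVec_transpose, ← mulVec_mulVec]
  simp only [dotProduct, mulVec_diagonal]
  exact Finset.sum_congr rfl fun k _ => by ring

/-- Simultaneous reduction of two quadratic forms. If `A ≥ m > 0`, then `A = R Rᵀ` and
`B = R (1 + diag e) Rᵀ` for an invertible `R`; the relative perturbation `e` and the inverse
`R⁻¹ = T` are controlled by the Frobenius norm of `B - A` and by `m`. If `A = V diag(s) Vᵀ`, one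
takes `R = V diag(√s) U` with `U` an eigenbasis of `diag(√s)⁻¹ Vᵀ (B - A) V diag(√s)⁻¹`. -/
theorem exists_simultaneous_diagonalization {A B : Matrix n n ℝ} (hA : A.IsHermitian)
    (hB : B.IsHermitian) {m : ℝ} (hm : 0 < m) (hAm : ∀ v, m * ∑ i, v i ^ 2 ≤ v ⬝ᵥ A *ᵥ v) :
    ∃ (R T : Matrix n n ℝ) (e : n → ℝ), R * T = 1 ∧ T * R = 1 ∧ A = R * Rᵀ ∧
      B = R * diagonal (fun k => 1 + e k) * Rᵀ ∧
      ∑ k, e k ^ 2 ≤ (∑ i, ∑ j, (B - A) i j ^ 2) / m ^ 2 ∧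
      ∀ v, ∑ k, (T *ᵥ v) k ^ 2 ≤ (∑ i, v i ^ 2) / m := by
  set V : Matrix n n ℝ := hA.eigenvectorUnitary.1 with hVdef
  set s := hA.eigenvalues with hs
  have hAV : A = V * diagonal s * Vᵀ := eq_mul_diagonal_mul_transpose hA
  have hV : V * Vᵀ = 1 := eigenvectorUnitary_mul_transpose hA
  have hV' : Vᵀ * V = 1 := mul_eq_one_comm.mp hV
  have hsm (k : n) : m ≤ s k := by
    have h := hAm (V *ᵥ Pi.single k 1)
    rw [sum_mulVec_sq hV', hAV, dotProduct_conj_diagonal_mulVec, mulVec_mulVec, hV',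
      one_mulVec] at h
    simpa [Pi.single_apply, ite_pow] using h
  have hs0 (k : n) : 0 < s k := hm.trans_le (hsm k)
  set p : n → ℝ := fun k => √(s k) with hp
  set q : n → ℝ := fun k => (√(s k))⁻¹ with hq
  have hpq : diagonal p * diagonal q = 1 := by
    rw [diagonal_mul_diagonal, ← diagonal_one]
    congr 1; ext k
    exact mul_inv_cancel₀ (Real.sqrt_ne_zero'.2 (hs0 k))
  have hqp : diagonal q * diagonal p = 1 := mul_eq_one_comm.mp hpq
  have hpp : diagonal p * diagonal p = diagonal s := by
    rw [diagonal_mul_diagonal]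
    congr 1; ext k
    exact Real.mul_self_sqrt (hs0 k).le
  have hq2 (k : n) : q k ^ 2 ≤ 1 / m := by
    simp only [hq, inv_pow, Real.sq_sqrt (hs0 k).le, one_div]
    exact inv_anti₀ hm (hsm k)
  set H : Matrix n n ℝ := diagonal q * (Vᵀ * (B - A) * V) * diagonal q with hH
  have hHh : H.IsHermitian := by
    have h1 : Aᵀ = A := hA
    have h2 : Bᵀ = B := hB
    change Hᵀ = H
    simp [hH, transpose_mul, h1, h2, Matrix.mul_assoc]
  set U : Matrix n n ℝ := hHh.eigenvectorUnitary.1 with hUdef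
  set e := hHh.eigenvalues with he
  have hHU : H = U * diagonal e * Uᵀ := eq_mul_diagonal_mul_transpose hHh
  have hU : U * Uᵀ = 1 := eigenvectorUnitary_mul_transpose hHh
  have hU' : Uᵀ * U = 1 := mul_eq_one_comm.mp hU
  have hRT : V * diagonal p * U * (Uᵀ * diagonal q * Vᵀ) = 1 := by
    calc _ = V * (diagonal p * ((U * Uᵀ) * diagonal q)) * Vᵀ := by
          simp only [Matrix.mul_assoc]
      _ = 1 := by rw [hU, Matrix.one_mul, hpq, Matrix.mul_one, hV]
  have hRR : A = V * diagonal p * U * (V * diagonal p * U)ᵀ := by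
    calc A = V * (diagonal p * ((U * Uᵀ) * diagonal p)) * Vᵀ := by
          rw [hU, Matrix.one_mul, hpp, ← hAV]
      _ = _ := by simp only [transpose_mul, diagonal_transpose, Matrix.mul_assoc]
  refine ⟨V * diagonal p * U, Uᵀ * diagonal q * Vᵀ, e, hRT, mul_eq_one_comm.mp hRT, hRR, ?_, ?_, ?_⟩
  · have h1 : diagonal (fun k => 1 + e k) = 1 + diagonal e := by
      rw [← diagonal_one, diagonal_add]
    have h2 : V * diagonal p * U * diagonal e * (V * diagonal p * U)ᵀ = B - A := by
      calc _ = V * diagonal p * (U * diagonal e * Uᵀ) * diagonal p * Vᵀ := by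
            simp only [transpose_mul, diagonal_transpose, Matrix.mul_assoc]
        _ = V * ((diagonal p * diagonal q) * (Vᵀ * (B - A) * V) * (diagonal q * diagonal p)) *
            Vᵀ := by rw [← hHU, hH]; simp only [Matrix.mul_assoc]
        _ = (V * Vᵀ) * (B - A) * (V * Vᵀ) := by
            rw [hpq, hqp, Matrix.one_mul, Matrix.mul_one]; simp only [Matrix.mul_assoc]
        _ = B - A := by rw [hV, Matrix.one_mul, Matrix.mul_one]
    rw [h1, Matrix.mul_add, Matrix.add_mul, Matrix.mul_one, h2, ← hRR]
    abel
  · have h1 : ∑ k, e k ^ 2 = ∑ i, ∑ j, H i j ^ 2 := by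
      rw [← sum_sq_conj hU hU H]
      have : Uᵀ * H * U = diagonal e := by
        calc _ = (Uᵀ * U) * diagonal e * (Uᵀ * U) := by
              conv_lhs => rw [hHU]
              simp only [Matrix.mul_assoc]
          _ = _ := by rw [hU', Matrix.one_mul, Matrix.mul_one]
      rw [this]
      simp [diagonal_apply, ite_pow]
    rw [h1, ← sum_sq_conj hV hV (B - A), Finset.sum_div]
    refine Finset.sum_le_sum fun i _ => ?_
    rw [Finset.sum_div]
    refine Finset.sum_le_sum fun j _ => ?_
    rw [hH, mul_diagonal, diagonal_mul]
    calc _ = (q i ^ 2 * q j ^ 2) * (Vᵀ * (B - A) * V) i j ^ 2 := by ring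
      _ ≤ (1 / m * (1 / m)) * (Vᵀ * (B - A) * V) i j ^ 2 := by
          refine mul_le_mul_of_nonneg_right ?_ (sq_nonneg _)
          exact mul_le_mul (hq2 i) (hq2 j) (sq_nonneg _) (by positivity)
      _ = _ := by field_simp
  · intro v
    rw [Matrix.mul_assoc, ← mulVec_mulVec, sum_mulVec_sq (by simpa using hU),
      ← sum_mulVec_sq (U := Vᵀ) (by simpa using hV) v, ← mulVec_mulVec, Finset.sum_div]
    refine Finset.sum_le_sum fun k _ => ?_
    rw [mulVec_diagonal, mul_pow, div_eq_mul_one_div, mul_comm]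
    exact mul_le_mul_of_nonneg_left (hq2 k) (sq_nonneg _)

end Matrices

/-! ### Water filling and the covariance of the gradients -/

section WaterFilling

variable {K D : ℕ}

theorem waterFill_isHermitian {A : Matrix (Fin K) (Fin K) ℝ} (hA : A.IsHermitian) (s : ℝ) :
    (waterFill hA s).IsHermitian := by
  change (waterFill hA s)ᵀ = waterFill hA s
  simp [waterFill, transpose_mul, Matrix.mul_assoc]

/-- Water filling at level `s` yields a matrix `≥ s`, in the order of quadratic forms. -/
theorem le_dotProduct_waterFill_mulVec {A : Matrix (Fin K) (Fin K) ℝ} (hA : A.IsHermitian) (s : ℝ)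
    (v : Fin K → ℝ) : s * ∑ i, v i ^ 2 ≤ v ⬝ᵥ waterFill hA s *ᵥ v := by
  rw [waterFill, dotProduct_conj_diagonal_mulVec,
    ← sum_mulVec_sq (U := (hA.eigenvectorUnitary : Matrix (Fin K) (Fin K) ℝ)ᵀ)
      (by simpa using eigenvectorUnitary_mul_transpose hA) v, Finset.mul_sum]
  exact Finset.sum_le_sum fun k _ => mul_le_mul_of_nonneg_right (le_max_right _ _) (sq_nonneg _)

theorem posSemidef_waterFill_sub {A : Matrix (Fin K) (Fin K) ℝ} (hA : A.IsHermitian) (s : ℝ) :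
    (waterFill hA s - A).PosSemidef := by
  refine PosSemidef.of_dotProduct_mulVec_nonneg ((waterFill_isHermitian hA s).sub hA) fun v => ?_
  have h : waterFill hA s - A = (hA.eigenvectorUnitary : Matrix (Fin K) (Fin K) ℝ) *
      diagonal (fun k => max (hA.eigenvalues k) s - hA.eigenvalues k) *
      (hA.eigenvectorUnitary : Matrix (Fin K) (Fin K) ℝ)ᵀ := by
    refine (congrArg (waterFill hA s - ·) (eq_mul_diagonal_mul_transpose hA)).trans ?_
    simp only [waterFill]
    rw [← Matrix.sub_mul, ← Matrix.mul_sub, diagonal_sub]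
  rw [h, star_trivial, dotProduct_conj_diagonal_mulVec]
  exact Finset.sum_nonneg fun k _ =>
    mul_nonneg (sub_nonneg.2 (le_max_left _ _)) (sq_nonneg _)

/-- Water filling is nonexpansive for the Frobenius norm. -/
theorem sum_sq_waterFill_sub_le {A B : Matrix (Fin K) (Fin K) ℝ} (hA : A.IsHermitian)
    (hB : B.IsHermitian) (s : ℝ) :
    ∑ i, ∑ j, (waterFill hA s - waterFill hB s) i j ^ 2 ≤ ∑ i, ∑ j, (A - B) i j ^ 2 := by
  refine (sum_sq_sub_le_of_spectral (eigenvectorUnitary_mul_transpose hA)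
    (eigenvectorUnitary_mul_transpose hB) hA.eigenvalues hB.eigenvalues _ _
    fun k l => abs_max_sub_max_le_abs _ _ _).trans_eq ?_
  rw [← eq_mul_diagonal_mul_transpose hA,
    ← eq_mul_diagonal_mul_transpose hB]

theorem norm_clip_le {C : ℝ} (hC : 0 < C) (x : EuclideanSpace ℝ (Fin K)) : ‖clip C x‖ ≤ C := by
  have h : 0 < max ‖x‖ C := lt_max_of_lt_right hC
  rw [clip, norm_smul, Real.norm_of_nonneg (by positivity), div_mul_eq_mul_div, div_le_iff₀ h]
  exact mul_le_mul_of_nonneg_left (le_max_left _ _) hC.le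

/-- The squared Frobenius norm of `a aᵀ - b bᵀ` is `‖a‖⁴ + ‖b‖⁴ - 2 ⟨a, b⟩²`. -/
theorem sum_sq_vecMulVec_sub_le {C : ℝ} {a b : EuclideanSpace ℝ (Fin K)} (ha : ‖a‖ ≤ C)
    (hb : ‖b‖ ≤ C) :
    ∑ i, ∑ j, (vecMulVec a.ofLp a.ofLp - vecMulVec b.ofLp b.ofLp) i j ^ 2 ≤ 2 * C ^ 4 := by
  have h1 : ∑ i, ∑ j, (vecMulVec a.ofLp a.ofLp - vecMulVec b.ofLp b.ofLp) i j ^ 2 =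
      (∑ i, a i ^ 2) * (∑ i, a i ^ 2) + (∑ i, b i ^ 2) * (∑ i, b i ^ 2) -
        2 * ((∑ i, a i * b i) * (∑ i, a i * b i)) := by
    rw [Finset.sum_mul_sum, Finset.sum_mul_sum, Finset.sum_mul_sum]
    simp only [Finset.mul_sum, ← Finset.sum_add_distrib, ← Finset.sum_sub_distrib]
    refine Finset.sum_congr rfl fun i _ => Finset.sum_congr rfl fun j _ => ?_
    simp only [Matrix.sub_apply, vecMulVec_apply]
    ring
  rw [h1, ← EuclideanSpace.real_norm_sq_eq, ← EuclideanSpace.real_norm_sq_eq]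
  have h2 : ‖a‖ ^ 4 ≤ C ^ 4 := pow_le_pow_left₀ (norm_nonneg _) ha 4
  have h3 : ‖b‖ ^ 4 ≤ C ^ 4 := pow_le_pow_left₀ (norm_nonneg _) hb 4
  nlinarith [mul_self_nonneg (∑ i, a i * b i)]

theorem sum_sq_gradCov_sub_le {B C : ℝ} {g g' : Fin D → EuclideanSpace ℝ (Fin K)}
    (hg : ∀ j, ‖g j‖ ≤ C) (hg' : ∀ j, ‖g' j‖ ≤ C) {j : Fin D} (h : ∀ l, l ≠ j → g l = g' l) :
    ∑ a, ∑ b, (gradCov B g - gradCov B g') a b ^ 2 ≤ 2 * (C ^ 2 / (B * D)) ^ 2 := by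
  have h1 : gradCov B g - gradCov B g' = (1 / (B * D)) •
      (vecMulVec (g j).ofLp (g j).ofLp - vecMulVec (g' j).ofLp (g' j).ofLp) := by
    rw [gradCov, gradCov, ← smul_sub, ← Finset.sum_sub_distrib,
      Finset.sum_eq_single_of_mem j (Finset.mem_univ j)]
    intro l _ hl
    rw [h l hl, sub_self]
  have h2 := sum_sq_vecMulVec_sub_le (hg j) (hg' j)
  calc _ = (1 / (B * D)) ^ 2 * ∑ a, ∑ b,
        (vecMulVec (g j).ofLp (g j).ofLp - vecMulVec (g' j).ofLp (g' j).ofLp) a b ^ 2 := by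
        rw [h1]
        simp only [Matrix.smul_apply, smul_eq_mul, mul_pow, ← Finset.mul_sum]
    _ ≤ (1 / (B * D)) ^ 2 * (2 * C ^ 4) := mul_le_mul_of_nonneg_left h2 (sq_nonneg _)
    _ = _ := by ring

end WaterFilling

/-! ### Moments of the density and privacy -/

section Divergence

open scoped ENNReal

variable {Y : Type*} [MeasurableSpace Y]

theorem lintegral_rnDeriv_withDensity_rpow (Q : Measure Y) [SigmaFinite Q] {f : Y → ℝ≥0∞}
    (hf : Measurable f) (α : ℝ) :
    ∫⁻ x, ((Q.withDensity f).rnDeriv Q x) ^ α ∂Q = ∫⁻ x, f x ^ α ∂Q := by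
  refine lintegral_congr_ae ?_
  filter_upwards [Measure.rnDeriv_withDensity Q hf] with x hx
  rw [hx]

/-- The moment `𝔼_Q[(dP/dQ)^α]` is invariant under injective changes of variables. -/
theorem lintegral_rnDeriv_map_rpow {Z : Type*} [MeasurableSpace Z] {e : Y → Z}
    (he : MeasurableEmbedding e) (P Q : Measure Y) [SigmaFinite P] [SigmaFinite Q] (α : ℝ) :
    ∫⁻ z, ((P.map e).rnDeriv (Q.map e) z) ^ α ∂(Q.map e) =
      ∫⁻ y, (P.rnDeriv Q y) ^ α ∂Q := by
  rw [he.lintegral_map]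
  refine lintegral_congr_ae ?_
  filter_upwards [he.rnDeriv_map P Q] with y hy
  rw [hy]

/-- A bound on the moment `𝔼_Q[(dP/dQ)^α]` is a bound on the Rényi divergence. -/
theorem renyiDiv_le {α ε : ℝ} (hα : 1 < α) {P Q : Measure Y} (hPQ : P ≪ Q)
    (h : ∫⁻ x, (P.rnDeriv Q x) ^ α ∂Q ≤ ENNReal.ofReal (Real.exp ((α - 1) * ε))) :
    renyiDiv α P Q ≤ (ε : EReal) := by
  have h0 : 0 < α - 1 := sub_pos.2 hα
  rw [renyiDiv, if_neg (by simp [hPQ])]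
  calc _ ≤ (((α - 1)⁻¹ : ℝ) : EReal) *
        ENNReal.log (ENNReal.ofReal (Real.exp ((α - 1) * ε))) :=
        mul_le_mul_of_nonneg_left (ENNReal.log_monotone h)
          (EReal.coe_nonneg.2 (inv_nonneg.2 h0.le))
    _ = ε := by
        rw [ENNReal.log_ofReal_of_pos (Real.exp_pos _), Real.log_exp, ← EReal.coe_mul,
          inv_mul_cancel_left₀ h0.ne']

/-- From a moment bound to approximate differential privacy. The density `p = dP/dQ` satisfies
`p ≤ t + t^{-(α-1)} p^α` for every threshold `t > 0`; integrate this for `t = exp ε'`, where the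
second term then contributes at most `δ`. -/
theorem measure_le_of_lintegral_rnDeriv_rpow_le {α ε δ : ℝ} (hα : 1 < α) (hδ : 0 < δ)
    {P Q : Measure Y} [SigmaFinite P] [SigmaFinite Q] (hPQ : P ≪ Q)
    (h : ∫⁻ x, (P.rnDeriv Q x) ^ α ∂Q ≤ ENNReal.ofReal (Real.exp ((α - 1) * ε))) (S : Set Y) :
    P S ≤ ENNReal.ofReal (Real.exp (ε + Real.log (1 / δ) / (α - 1))) * Q S +
      ENNReal.ofReal δ := by
  have h0 : 0 < α - 1 := sub_pos.2 hα
  set ε' := ε + Real.log (1 / δ) / (α - 1) with hε'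
  set t := ENNReal.ofReal (Real.exp ε') with ht
  set c := ENNReal.ofReal (Real.exp (-((α - 1) * ε'))) with hc
  have hpt (p : ℝ≥0∞) : p ≤ t + c * p ^ α := by
    rcases le_total p t with hp | hp
    · exact hp.trans le_self_add
    · rcases eq_or_ne p ∞ with rfl | hptop
      · rw [ENNReal.top_rpow_of_pos (by linarith), ENNReal.mul_top]
        · simp
        · simpa [hc] using Real.exp_pos _
      refine le_trans ?_ le_add_self
      have htp : (0 : ℝ≥0∞) < t := by simpa [ht] using Real.exp_pos _
      have hp0 : p ≠ 0 := (htp.trans_le hp).ne'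
      have h1 : c * t ^ (α - 1) = 1 := by
        rw [hc, ht, ENNReal.ofReal_rpow_of_pos (Real.exp_pos _), ← ENNReal.ofReal_mul
          (Real.exp_pos _).le, ← Real.exp_mul, ← Real.exp_add]
        simp [mul_comm]
      calc p = c * t ^ (α - 1) * p := by rw [h1, one_mul]
        _ ≤ c * p ^ (α - 1) * p := by gcongr
        _ = c * p ^ α := by
          rw [mul_assoc]
          congr 1
          conv_lhs => rw [← ENNReal.rpow_one p, ← ENNReal.rpow_mul, one_mul,
            ← ENNReal.rpow_add _ _ hp0 hptop]
          rw [sub_add_cancel]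
  calc P S = ∫⁻ x in S, P.rnDeriv Q x ∂Q := (Measure.setLIntegral_rnDeriv hPQ S).symm
    _ ≤ ∫⁻ x in S, (t + c * P.rnDeriv Q x ^ α) ∂Q := lintegral_mono fun x => hpt _
    _ = t * Q S + c * ∫⁻ x in S, P.rnDeriv Q x ^ α ∂Q := by
        rw [lintegral_add_left measurable_const, setLIntegral_const, lintegral_const_mul]
        exact (Measure.measurable_rnDeriv P Q).pow_const α
    _ ≤ t * Q S + c * ENNReal.ofReal (Real.exp ((α - 1) * ε)) := by
        gcongr
        exact (setLIntegral_le_lintegral _ _).trans h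
    _ = t * Q S + ENNReal.ofReal δ := by
        rw [hc, ← ENNReal.ofReal_mul (Real.exp_pos _).le, ← Real.exp_add]
        have : -((α - 1) * ε') + (α - 1) * ε = Real.log δ := by
          rw [hε', mul_add, mul_div_cancel₀ _ h0.ne', one_div, Real.log_inv]
          ring
        rw [this, Real.exp_log hδ]

theorem lintegral_pi_prod {ι : Type*} [Fintype ι] {Ω : ι → Type*} [∀ i, MeasurableSpace (Ω i)]
    (Q : ∀ i, Measure (Ω i)) [∀ i, IsProbabilityMeasure (Q i)] {f : ∀ i, Ω i → ℝ≥0∞}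
    (hf : ∀ i, Measurable (f i)) :
    ∫⁻ x, ∏ i, f i (x i) ∂(Measure.pi Q) = ∏ i, ∫⁻ x, f i x ∂(Q i) := by
  refine (lintegral_prod_eq_prod_lintegral_of_indepFun Finset.univ
    (fun i (x : ∀ i, Ω i) => f i (x i))
    (iIndepFun_pi fun i => (hf i).aemeasurable)
    fun i => (hf i).comp (measurable_pi_apply i)).trans ?_
  refine Finset.prod_congr rfl fun i _ => ?_
  rw [← lintegral_map (hf i) (measurable_pi_apply i), (measurePreserving_eval Q i).map_eq]

theorem pi_withDensity {ι : Type*} [Fintype ι] {Ω : ι → Type*} [∀ i, MeasurableSpace (Ω i)]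
    (Q : ∀ i, Measure (Ω i)) [∀ i, IsProbabilityMeasure (Q i)] {f : ∀ i, Ω i → ℝ≥0∞}
    (hf : ∀ i, Measurable (f i)) [∀ i, SigmaFinite ((Q i).withDensity (f i))] :
    Measure.pi (fun i => (Q i).withDensity (f i)) =
      (Measure.pi Q).withDensity fun x => ∏ i, f i (x i) := by
  refine Measure.pi_eq fun s hs => ?_
  rw [withDensity_apply _ (.univ_pi hs), ← lintegral_indicator (.univ_pi hs)]
  have h (x : ∀ i, Ω i) : (Set.univ.pi s).indicator (fun x => ∏ i, f i (x i)) x =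
      ∏ i, (s i).indicator (f i) (x i) := by
    classical
    by_cases hx : x ∈ Set.univ.pi s
    · rw [Set.indicator_of_mem hx]
      exact Finset.prod_congr rfl fun i _ => (Set.indicator_of_mem (hx i trivial) _).symm
    · rw [Set.indicator_of_notMem hx]
      simp only [Set.mem_pi, Set.mem_univ, true_implies, not_forall] at hx
      obtain ⟨i, hi⟩ := hx
      exact (Finset.prod_eq_zero (Finset.mem_univ i) (Set.indicator_of_notMem hi _)).symm
  simp only [h]
  rw [lintegral_pi_prod Q fun i => (hf i).indicator (hs i)]
  refine Finset.prod_congr rfl fun i _ => ?_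
  rw [lintegral_indicator (hs i), withDensity_apply _ (hs i)]

end Divergence

/-! ### Moments of Gaussian densities -/

section GaussianDivergence

open scoped ENNReal NNReal

theorem gaussianReal_eq_withDensity_div (a b : ℝ) {u v : ℝ≥0} (hu : u ≠ 0) (hv : v ≠ 0) :
    gaussianReal a u =
      (gaussianReal b v).withDensity fun x => gaussianPDF a u x / gaussianPDF b v x := by
  rw [gaussianReal_of_var_ne_zero a hu, gaussianReal_of_var_ne_zero b hv]
  refine Eq.trans ?_ (withDensity_mul _ (measurable_gaussianPDF b v)
    ((measurable_gaussianPDF a u).div (measurable_gaussianPDF b v)))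
  congr 1
  ext x
  exact (ENNReal.mul_div_cancel (gaussianPDF_pos b hv x).ne' gaussianPDF_ne_top).symm

theorem gaussianPDF_eq_ofReal_exp (a : ℝ) {v : ℝ≥0} (hv : v ≠ 0) (x : ℝ) :
    gaussianPDF a v x = ENNReal.ofReal (Real.exp
      (-(Real.log (2 * Real.pi) + Real.log v) / 2 - (x - a) ^ 2 / (2 * v))) := by
  have hv' : (0 : ℝ) < v := by exact_mod_cast pos_iff_ne_zero.2 hv
  rw [gaussianPDF, gaussianPDFReal, sub_eq_add_neg (_ / 2), Real.exp_add, ← neg_div (2 * (v : ℝ)),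
    ← Real.log_mul (by positivity) hv'.ne', neg_div, neg_div, Real.exp_neg,
    Real.exp_neg, Real.exp_half, Real.exp_log (by positivity)]

/-- The exponent of the moment `𝔼_Q[(dP/dQ)^α]` for `P = N(a, 1)`, `Q = N(b, v)`, with
`d = a - b`. -/
noncomputable def gaussianMomentExponent (α d v : ℝ) : ℝ :=
  α * (α - 1) * d ^ 2 / (2 * (1 + α * (v - 1))) +
    (α * Real.log v - Real.log (1 + α * (v - 1))) / 2

/-- Completing the square: up to a constant factor, `p^α q^{1-α}` is the density of
`N((α v a + (1 - α) b) / s, v / s)` with `s = 1 + α (v - 1)`. -/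
theorem lintegral_gaussianPDF_div_rpow (α a b : ℝ) {v : ℝ≥0} (hv : v ≠ 0)
    (hs : 0 < 1 + α * ((v : ℝ) - 1)) :
    ∫⁻ x, (gaussianPDF a 1 x / gaussianPDF b v x) ^ α ∂(gaussianReal b v) =
      ENNReal.ofReal (Real.exp (gaussianMomentExponent α (a - b) v)) := by
  have hv' : (0 : ℝ) < v := by exact_mod_cast pos_iff_ne_zero.2 hv
  set s : ℝ := 1 + α * ((v : ℝ) - 1) with hsdef
  set w : ℝ≥0 := v / s.toNNReal with hw
  have hwv : (w : ℝ) = v / s := by simp [hw, hs.le]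
  have hw0 : w ≠ 0 := by
    have : (0 : ℝ) < w := by rw [hwv]; positivity
    exact_mod_cast this.ne'
  set c : ℝ := (α * v * a + (1 - α) * b) / s with hc
  have hm : Measurable fun x => (gaussianPDF a 1 x / gaussianPDF b v x) ^ α :=
    ((measurable_gaussianPDF a 1).div (measurable_gaussianPDF b v)).pow_const α
  rw [gaussianReal_of_var_ne_zero b hv, lintegral_withDensity_eq_lintegral_mul _
    (measurable_gaussianPDF b v) hm]
  have h (x : ℝ) : (gaussianPDF b v * fun x => (gaussianPDF a 1 x / gaussianPDF b v x) ^ α) x =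
      ENNReal.ofReal (Real.exp (gaussianMomentExponent α (a - b) v)) * gaussianPDF c w x := by
    rw [Pi.mul_apply, gaussianPDF_eq_ofReal_exp a one_ne_zero, gaussianPDF_eq_ofReal_exp b hv,
      gaussianPDF_eq_ofReal_exp c hw0, ← ENNReal.ofReal_div_of_pos (Real.exp_pos _),
      ← Real.exp_sub, ENNReal.ofReal_rpow_of_pos (Real.exp_pos _), ← Real.exp_mul,
      ← ENNReal.ofReal_mul (Real.exp_pos _).le, ← ENNReal.ofReal_mul (Real.exp_pos _).le,
      ← Real.exp_add, ← Real.exp_add]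
    congr 2
    rw [hwv, Real.log_div hv'.ne' hs.ne', gaussianMomentExponent, ← hsdef, hc]
    simp only [NNReal.coe_one, Real.log_one]
    have hs0 := hs.ne'
    have hv0 := hv'.ne'
    have key : -(x - b) ^ 2 / (2 * v) +
        (-(x - a) ^ 2 / 2 + (x - b) ^ 2 / (2 * v)) * α =
        α * (α - 1) * (a - b) ^ 2 / (2 * s) -
          (x - (α * v * a + (1 - α) * b) / s) ^ 2 / (2 * (v / s)) := by
      field_simp
      rw [hsdef]
      ring
    linear_combination key
  simp only [h]
  rw [lintegral_const_mul _ (measurable_gaussianPDF c w), lintegral_gaussianPDF_eq_one c hw0,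
    mul_one]

theorem pi_gaussianReal_absolutelyContinuous_and_lintegral {ι : Type*} [Fintype ι] {α : ℝ}
    (hα : 0 ≤ α) (a b : ι → ℝ) {v : ι → ℝ≥0} (hv : ∀ k, v k ≠ 0)
    (hs : ∀ k, 0 < 1 + α * ((v k : ℝ) - 1)) :
    let P := Measure.pi fun k => gaussianReal (a k) 1
    let Q := Measure.pi fun k => gaussianReal (b k) (v k)
    P ≪ Q ∧ ∫⁻ x, (P.rnDeriv Q x) ^ α ∂Q =
      ENNReal.ofReal (Real.exp (∑ k, gaussianMomentExponent α (a k - b k) (v k))) := by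
  intro P Q
  let f (k : ι) (x : ℝ) : ℝ≥0∞ := gaussianPDF (a k) 1 x / gaussianPDF (b k) (v k) x
  have hf (k : ι) : Measurable (f k) :=
    (measurable_gaussianPDF _ _).div (measurable_gaussianPDF _ _)
  have hd (k : ι) : gaussianReal (a k) 1 = (gaussianReal (b k) (v k)).withDensity (f k) :=
    gaussianReal_eq_withDensity_div _ _ one_ne_zero (hv k)
  have hsf (k : ι) : SigmaFinite ((gaussianReal (b k) (v k)).withDensity (f k)) := by
    rw [← hd k]; infer_instance
  have hP : P = Q.withDensity fun x => ∏ k, f k (x k) := by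
    rw [← pi_withDensity _ hf]
    simp only [P, hd]
  rw [hP]
  refine ⟨withDensity_absolutelyContinuous _ _, ?_⟩
  rw [lintegral_rnDeriv_withDensity_rpow]
  · simp only [← ENNReal.prod_rpow_of_nonneg hα]
    rw [lintegral_pi_prod _ fun k => (hf k).pow_const α, Real.exp_sum,
      ENNReal.ofReal_prod_of_nonneg fun k _ => (Real.exp_pos _).le]
    exact Finset.prod_congr rfl fun k _ => lintegral_gaussianPDF_div_rpow α _ _ (hv k) (hs k)
  · exact Finset.measurable_prod _ fun k _ => (hf k).comp (measurable_pi_apply k)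

end GaussianDivergence

/-! ### Bounds on the moment exponent -/

section ExponentBound

/-- The two logarithms cancel to first order in `e`:
`α log (1 + e) - log (1 + α e) ≤ α e - α e / (1 + α e) = α² e² / (1 + α e)`. -/
theorem gaussianMomentExponent_one_add_le {α e : ℝ} (hα : 0 ≤ α) (d : ℝ) (he : 0 < 1 + e)
    (hs : 0 < 1 + α * e) :
    gaussianMomentExponent α d (1 + e) ≤
      (α * (α - 1) * d ^ 2 + α ^ 2 * e ^ 2) / 2 * (1 / (1 + α * e)) := by
  rw [gaussianMomentExponent, add_sub_cancel_left]
  have h1 : α * Real.log (1 + e) ≤ α * e :=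
    mul_le_mul_of_nonneg_left (by linarith [Real.log_le_sub_one_of_pos he]) hα
  have h2 := Real.one_sub_inv_le_log_of_pos hs
  have h3 : α * e - (1 - (1 + α * e)⁻¹) = α ^ 2 * e ^ 2 * (1 / (1 + α * e)) := by
    field_simp
    ring
  have h4 : α * (α - 1) * d ^ 2 / (2 * (1 + α * e)) =
      α * (α - 1) * d ^ 2 / 2 * (1 / (1 + α * e)) := by field_simp
  rw [h4]
  linarith

/-- Summation over the coordinates. The bound on `e` gives `1 + α e_k ≥ (m - 2 α c) / m`, so one
factor `m` cancels against the `m` in the bounds on `d` and `e`. -/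
theorem sum_gaussianMomentExponent_le {ι : Type*} [Fintype ι] {α m c r : ℝ} (hα : 1 < α)
    (hc : 0 ≤ c) (hm : 0 < m - 2 * α * c) {d e : ι → ℝ}
    (he : ∑ k, e k ^ 2 ≤ 2 * c ^ 2 / m ^ 2) (hd : ∑ k, d k ^ 2 ≤ r / m) :
    (∀ k, 0 < 1 + e k ∧ 0 < 1 + α * e k) ∧
      ∑ k, gaussianMomentExponent α (d k) (1 + e k) ≤
        (α * (α - 1) * r / 2 + α * c) * (1 / (m - 2 * α * c)) := by
  have hα0 : 0 < α := by linarith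
  have hm0 : 0 < m := by nlinarith [mul_nonneg hα0.le hc]
  have hek (k : ι) : -(2 * c / m) ≤ e k := by
    have h1 : e k ^ 2 ≤ 2 * c ^ 2 / m ^ 2 :=
      (Finset.single_le_sum (fun l _ => sq_nonneg (e l)) (Finset.mem_univ k)).trans he
    refine (abs_le_of_sq_le_sq' (h1.trans ?_) (by positivity)).1
    rw [div_pow]
    gcongr
    nlinarith [sq_nonneg c]
  have hs (k : ι) : (m - 2 * α * c) / m ≤ 1 + α * e k := by
    have := mul_le_mul_of_nonneg_left (hek k) hα0.le
    have h2 : (m - 2 * α * c) / m = 1 + α * -(2 * c / m) := by field_simp; ring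
    linarith
  have hs0 (k : ι) : 0 < 1 + α * e k := (div_pos hm hm0).trans_le (hs k)
  have he0 (k : ι) : 0 < 1 + e k := by
    by_contra h
    -- Since `α > 1`, `e k ≤ -1` would give `1 + α e k < 0`.
    have := hs0 k
    nlinarith
  refine ⟨fun k => ⟨he0 k, hs0 k⟩, ?_⟩
  calc ∑ k, gaussianMomentExponent α (d k) (1 + e k)
      ≤ ∑ k, (α * (α - 1) * d k ^ 2 + α ^ 2 * e k ^ 2) / 2 * (m / (m - 2 * α * c)) := by
        refine Finset.sum_le_sum fun k _ =>
          (gaussianMomentExponent_one_add_le hα0.le (d k) (he0 k) (hs0 k)).trans ?_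
        refine mul_le_mul_of_nonneg_left ?_ ?_
        · rw [← one_div_div (m - 2 * α * c) m]
          exact one_div_le_one_div_of_le (div_pos hm hm0) (hs k)
        · have : 0 ≤ α - 1 := by linarith
          positivity
    _ = (α * (α - 1) * ∑ k, d k ^ 2 + α ^ 2 * ∑ k, e k ^ 2) / 2 * (m / (m - 2 * α * c)) := by
        rw [← Finset.sum_mul, ← Finset.sum_div, Finset.sum_add_distrib, Finset.mul_sum,
          Finset.mul_sum]
    _ ≤ (α * (α - 1) * (r / m) + α ^ 2 * (2 * c ^ 2 / m ^ 2)) / 2 * (m / (m - 2 * α * c)) := by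
        have : 0 ≤ α - 1 := by linarith
        gcongr
    _ = (α * (α - 1) * r / 2 + α * c * (α * c / m)) * (1 / (m - 2 * α * c)) := by
        field_simp
    _ ≤ _ := by
        refine mul_le_mul_of_nonneg_right ?_ (one_div_pos.2 hm).le
        have : α * c / m ≤ 1 := by
          rw [div_le_one hm0]
          nlinarith [mul_nonneg hα0.le hc]
        have h1 := mul_le_mul_of_nonneg_left this (mul_nonneg hα0.le hc)
        linarith

end ExponentBound

/-! ### The law of the aggregated update -/

section Law

open Complex
open scoped RealInnerProductSpace NNReal

variable {N D K : ℕ}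

instance isProbabilityMeasure_weightLaw (B : ℝ) : IsProbabilityMeasure (weightLaw D B) := by
  rw [weightLaw]
  infer_instance

instance isProbabilityMeasure_aggregateLaw (B σ : ℝ)
    (g : Fin N → Fin D → EuclideanSpace ℝ (Fin K)) : IsProbabilityMeasure (aggregateLaw B σ g) := by
  rw [aggregateLaw]
  exact Measure.isProbabilityMeasure_map (by fun_prop)

theorem dotProduct_gradCov_mulVec (B : ℝ) (g : Fin D → EuclideanSpace ℝ (Fin K))
    (t : EuclideanSpace ℝ (Fin K)) :
    t.ofLp ⬝ᵥ gradCov B g *ᵥ t.ofLp = 1 / (B * D) * ∑ j, ⟪g j, t⟫ ^ 2 := by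
  simp only [gradCov, smul_mulVec, dotProduct_smul, smul_eq_mul, sum_mulVec, dotProduct_sum,
    vecMulVec_mulVec, PiLp.inner_apply]
  congr 1
  refine Finset.sum_congr rfl fun j _ => ?_
  simp [dotProduct, sq, mul_comm]

/-- A Gaussian weighted sum of the gradients has mean `(1/D) ∑ j, g_j` and covariance
`gradCov B g`. -/
theorem charFun_map_weightLaw {B : ℝ} (hB : 0 ≤ B) (g : Fin D → EuclideanSpace ℝ (Fin K))
    (t : EuclideanSpace ℝ (Fin K)) :
    charFun ((weightLaw D B).map fun w => ∑ j, w j • g j) t =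
      exp (⟪t, (1 / (D : ℝ)) • ∑ j, g j⟫ * I - (t.ofLp ⬝ᵥ gradCov B g *ᵥ t.ofLp : ℝ) / 2) := by
  set s : EuclideanSpace ℝ (Fin D) := WithLp.toLp 2 fun j => ⟪g j, t⟫ with hs
  have hs' (u : EuclideanSpace ℝ (Fin D)) : ⟪u, s⟫ = ∑ j, u j * ⟪g j, t⟫ := by
    rw [EuclideanSpace.inner_eq_star_dotProduct]
    simp [dotProduct, hs, mul_comm]
  have h1 : charFun ((weightLaw D B).map fun w => ∑ j, w j • g j) t =
      charFun (weightLaw D B) s := by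
    rw [charFun_apply, charFun_apply, integral_map (by fun_prop) (by fun_prop)]
    refine integral_congr_ae (.of_forall fun w => ?_)
    simp only [sum_inner, real_inner_smul_left, hs']
  have hpsd : ((1 / (B * D)) • (1 : Matrix (Fin D) (Fin D) ℝ)).PosSemidef :=
    PosSemidef.one.smul (by positivity)
  rw [h1, weightLaw, charFun_multivariateGaussian hpsd, dotProduct_gradCov_mulVec]
  have h2 : ⟪s, WithLp.toLp 2 fun _ => 1 / (D : ℝ)⟫ = ⟪t, (1 / (D : ℝ)) • ∑ j, g j⟫ := by
    rw [real_inner_comm, hs', real_inner_comm _ t, real_inner_smul_left, sum_inner, Finset.mul_sum]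
  have h3 : s.ofLp ⬝ᵥ ((1 / (B * D)) • (1 : Matrix (Fin D) (Fin D) ℝ)) *ᵥ s.ofLp =
      1 / (B * D) * ∑ j, ⟪g j, t⟫ ^ 2 := by
    rw [smul_mulVec, one_mulVec, dotProduct_smul, smul_eq_mul]
    simp [dotProduct, sq, hs]
  rw [h2, h3]

/-- The covariances of the gradient noise and of the water-filling noise add up to the
water-filled covariance. -/
theorem charFun_map_userLaw {B σ : ℝ} (hB : 0 ≤ B) (g : Fin D → EuclideanSpace ℝ (Fin K))
    (t : EuclideanSpace ℝ (Fin K)) :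
    charFun (((weightLaw D B).prod (multivariateGaussian 0 (wfNoiseCov B σ g))).map
        fun p => (∑ j, p.1 j • g j) + p.2) t =
      exp (⟪t, (1 / (D : ℝ)) • ∑ j, g j⟫ * I -
        (t.ofLp ⬝ᵥ waterFill (gradCov_isHermitian B g) (σ ^ 2) *ᵥ t.ofLp : ℝ) / 2) := by
  have hm : Measurable fun w : EuclideanSpace ℝ (Fin D) => ∑ j, w j • g j := by fun_prop
  have := Measure.isProbabilityMeasure_map (μ := weightLaw D B) hm.aemeasurable
  have h1 : ((weightLaw D B).prod (multivariateGaussian 0 (wfNoiseCov B σ g))).map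
        (fun p => (∑ j, p.1 j • g j) + p.2) =
      (((weightLaw D B).map fun w => ∑ j, w j • g j).prod
        (multivariateGaussian 0 (wfNoiseCov B σ g))).map fun p => p.1 + p.2 := by
    conv_rhs => rw [← Measure.map_id (μ := multivariateGaussian 0 (wfNoiseCov B σ g))]
    rw [Measure.map_prod_map _ _ hm measurable_id, Measure.map_map (by fun_prop) (by fun_prop)]
    rfl
  rw [h1, charFun_map_add_prod_eq_mul, Pi.mul_apply, charFun_map_weightLaw hB,
    wfNoiseCov, charFun_multivariateGaussian (posSemidef_waterFill_sub _ _), ← Complex.exp_add]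
  congr 1
  rw [sub_mulVec, dotProduct_sub]
  simp only [inner_zero_right, ofReal_sub]
  push_cast
  ring

/-- The covariance matrix `∑ k, Σ_{k,+}` of the aggregated update. -/
noncomputable def aggregateCov (B σ : ℝ) (g : Fin N → Fin D → EuclideanSpace ℝ (Fin K)) :
    Matrix (Fin K) (Fin K) ℝ :=
  ∑ k, waterFill (gradCov_isHermitian B (g k)) (σ ^ 2)

/-- The mean `∑ k, (1/D) ∑ j, g_{k,j}` of the aggregated update. -/
noncomputable def aggregateMean (g : Fin N → Fin D → EuclideanSpace ℝ (Fin K)) :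
    EuclideanSpace ℝ (Fin K) :=
  ∑ k, (1 / (D : ℝ)) • ∑ j, g k j

theorem charFun_aggregateLaw {B σ : ℝ} (hB : 0 ≤ B)
    (g : Fin N → Fin D → EuclideanSpace ℝ (Fin K)) (t : EuclideanSpace ℝ (Fin K)) :
    charFun (aggregateLaw B σ g) t =
      exp (⟪t, aggregateMean g⟫ * I - (t.ofLp ⬝ᵥ aggregateCov B σ g *ᵥ t.ofLp : ℝ) / 2) := by
  have hm (k : Fin N) : Measurable fun p : EuclideanSpace ℝ (Fin D) × EuclideanSpace ℝ (Fin K) =>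
      (∑ j, p.1 j • g k j) + p.2 := by fun_prop
  have (k : Fin N) := Measure.isProbabilityMeasure_map
    (μ := (weightLaw D B).prod (multivariateGaussian 0 (wfNoiseCov B σ (g k)))) (hm k).aemeasurable
  have h1 : aggregateLaw B σ g = (Measure.pi fun k =>
      ((weightLaw D B).prod (multivariateGaussian 0 (wfNoiseCov B σ (g k)))).map
        fun p => (∑ j, p.1 j • g k j) + p.2).map fun x => ∑ k, x k := by
    rw [← Measure.pi_map_pi fun k => (hm k).aemeasurable,
      Measure.map_map (by fun_prop) (by fun_prop)]
    rfl
  rw [h1, charFun_map_sum_pi_eq_prod, Finset.prod_apply]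
  simp only [charFun_map_userLaw hB]
  rw [← Complex.exp_sum, Finset.sum_sub_distrib, ← Finset.sum_mul, ← Finset.sum_div,
    aggregateMean, aggregateCov, inner_sum, sum_mulVec, dotProduct_sum]
  push_cast
  rfl

theorem charFun_map_pi_gaussianReal {n : Type*} [Fintype n] [DecidableEq n] (R : Matrix n n ℝ)
    (a : n → ℝ) (v : n → ℝ≥0) (t : EuclideanSpace ℝ n) :
    charFun ((Measure.pi fun k => gaussianReal (a k) (v k)).map
        fun x => (WithLp.toLp 2 (R *ᵥ x) : EuclideanSpace ℝ n)) t =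
      exp (⟪t, WithLp.toLp 2 (R *ᵥ a)⟫ * I -
        (t.ofLp ⬝ᵥ (R * diagonal (fun k => (v k : ℝ)) * Rᵀ) *ᵥ t.ofLp : ℝ) / 2) := by
  have h1 : charFun ((Measure.pi fun k => gaussianReal (a k) (v k)).map
        fun x => (WithLp.toLp 2 (R *ᵥ x) : EuclideanSpace ℝ n)) t =
      charFun ((Measure.pi fun k => gaussianReal (a k) (v k)).map (WithLp.toLp 2))
        (WithLp.toLp 2 (Rᵀ *ᵥ t.ofLp)) := by
    rw [charFun_apply, charFun_apply, integral_map (by fun_prop) (by fun_prop),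
      integral_map (by fun_prop) (by fun_prop)]
    refine integral_congr_ae (.of_forall fun x => ?_)
    simp only [EuclideanSpace.inner_eq_star_dotProduct, star_trivial]
    rw [dotProduct_mulVec, mulVec_transpose]
  rw [h1, charFun_pi]
  simp only [charFun_gaussianReal]
  rw [← Complex.exp_sum, Finset.sum_sub_distrib, ← Finset.sum_mul, ← Finset.sum_div,
    dotProduct_conj_diagonal_mulVec]
  have h2 : ⟪t, WithLp.toLp 2 (R *ᵥ a)⟫ = ∑ k, (Rᵀ *ᵥ t.ofLp) k * a k := by
    rw [EuclideanSpace.inner_eq_star_dotProduct, star_trivial, dotProduct_comm, dotProduct_mulVec,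
      mulVec_transpose]
    rfl
  rw [h2]
  push_cast
  rfl

/-- A factorisation `S = R diag(v) Rᵀ` of the covariance realises the law of the aggregated
update as a linear image of a product of one-dimensional Gaussian laws. -/
theorem aggregateLaw_eq_map_pi {B σ : ℝ} (hB : 0 ≤ B)
    (g : Fin N → Fin D → EuclideanSpace ℝ (Fin K)) {R : Matrix (Fin K) (Fin K) ℝ} {a : Fin K → ℝ}
    {v : Fin K → ℝ≥0} (ha : R *ᵥ a = (aggregateMean g).ofLp)
    (hv : aggregateCov B σ g = R * diagonal (fun k => (v k : ℝ)) * Rᵀ) :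
    aggregateLaw B σ g = (Measure.pi fun k => gaussianReal (a k) (v k)).map
      fun x => (WithLp.toLp 2 (R *ᵥ x) : EuclideanSpace ℝ (Fin K)) := by
  refine Measure.ext_of_charFun (funext fun t => ?_)
  rw [charFun_aggregateLaw hB, charFun_map_pi_gaussianReal, ha, hv]

theorem aggregateCov_isHermitian (B σ : ℝ) (g : Fin N → Fin D → EuclideanSpace ℝ (Fin K)) :
    (aggregateCov B σ g).IsHermitian := by
  change (aggregateCov B σ g)ᵀ = aggregateCov B σ g
  rw [aggregateCov, transpose_sum]
  exact Finset.sum_congr rfl fun k _ => waterFill_isHermitian _ _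

theorem le_dotProduct_aggregateCov_mulVec (B σ : ℝ)
    (g : Fin N → Fin D → EuclideanSpace ℝ (Fin K)) (v : Fin K → ℝ) :
    N * σ ^ 2 * ∑ i, v i ^ 2 ≤ v ⬝ᵥ aggregateCov B σ g *ᵥ v := by
  rw [aggregateCov, sum_mulVec, dotProduct_sum, mul_assoc]
  simpa using Finset.card_nsmul_le_sum Finset.univ
    (fun k => v ⬝ᵥ waterFill (gradCov_isHermitian B (g k)) (σ ^ 2) *ᵥ v) _
    fun k _ => le_dotProduct_waterFill_mulVec _ _ v

variable {i : Fin N} {g g' : Fin N → Fin D → EuclideanSpace ℝ (Fin K)} {C : ℝ}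

theorem norm_aggregateMean_sub_le (hg : ∀ k j, ‖g k j‖ ≤ C) (hg' : ∀ k j, ‖g' k j‖ ≤ C)
    (h : AdjUser i g g') : ‖aggregateMean g - aggregateMean g'‖ ≤ 2 * C / D := by
  obtain ⟨h1, j, h2⟩ := h
  have h3 : aggregateMean g - aggregateMean g' = (1 / (D : ℝ)) • (g i j - g' i j) := by
    rw [aggregateMean, aggregateMean, ← Finset.sum_sub_distrib,
      Finset.sum_eq_single_of_mem i (Finset.mem_univ i) fun k _ hk => by rw [h1 k hk, sub_self],
      ← smul_sub, ← Finset.sum_sub_distrib, Finset.sum_eq_single_of_mem j (Finset.mem_univ j)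
        fun l _ hl => by rw [h2 l hl, sub_self]]
  rw [h3, norm_smul, Real.norm_of_nonneg (by positivity), one_div_mul_eq_div]
  gcongr
  linarith [norm_sub_le (g i j) (g' i j), hg i j, hg' i j]

/-- Only user `i`'s term changes, by the water filling of a perturbation of rank two. -/
theorem sum_sq_aggregateCov_sub_le (B σ : ℝ) (hg : ∀ k j, ‖g k j‖ ≤ C)
    (hg' : ∀ k j, ‖g' k j‖ ≤ C) (h : AdjUser i g g') :
    ∑ a, ∑ b, (aggregateCov B σ g' - aggregateCov B σ g) a b ^ 2 ≤
      2 * (C ^ 2 / (B * D)) ^ 2 := by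
  obtain ⟨h1, j, h2⟩ := h
  have h3 : aggregateCov B σ g' - aggregateCov B σ g =
      waterFill (gradCov_isHermitian B (g' i)) (σ ^ 2) -
        waterFill (gradCov_isHermitian B (g i)) (σ ^ 2) := by
    rw [aggregateCov, aggregateCov, ← Finset.sum_sub_distrib]
    refine Finset.sum_eq_single_of_mem i (Finset.mem_univ i) fun k _ hk => ?_
    exact sub_eq_zero.2
      (congrArg (fun x => waterFill (gradCov_isHermitian B x) (σ ^ 2)) (h1 k hk).symm)
  rw [h3]
  exact (sum_sq_waterFill_sub_le _ _ _).trans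
    (sum_sq_gradCov_sub_le (hg' i) (hg i) fun l hl => (h2 l hl).symm)

/-- The moment bound behind both privacy guarantees. Both laws are images of product Gaussian laws
under the same injective linear map `R`, which leaves the moment unchanged. -/
theorem aggregateLaw_moment_le {B σ α : ℝ} (hB : 0 ≤ B) (hα : 1 < α)
    (hm : 0 < N * σ ^ 2 - 2 * α * (C ^ 2 / (B * D))) (hg : ∀ k j, ‖g k j‖ ≤ C)
    (hg' : ∀ k j, ‖g' k j‖ ≤ C) (h : AdjUser i g g') :
    aggregateLaw B σ g ≪ aggregateLaw B σ g' ∧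
      ∫⁻ x, ((aggregateLaw B σ g).rnDeriv (aggregateLaw B σ g') x) ^ α ∂(aggregateLaw B σ g') ≤
        ENNReal.ofReal (Real.exp ((α * (α - 1) * (2 * C / D) ^ 2 / 2 + α * (C ^ 2 / (B * D))) *
          (1 / (N * σ ^ 2 - 2 * α * (C ^ 2 / (B * D)))))) := by
  have hc : 0 ≤ C ^ 2 / (B * D) := by positivity
  have hm0 : 0 < N * σ ^ 2 := by nlinarith [mul_nonneg (zero_le_one.trans hα.le) hc]
  obtain ⟨R, T, e, hRT, hTR, hS, hS', he, hT⟩ := exists_simultaneous_diagonalization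
    (aggregateCov_isHermitian B σ g) (aggregateCov_isHermitian B σ g') hm0
    (le_dotProduct_aggregateCov_mulVec B σ g)
  set a : Fin K → ℝ := T *ᵥ (aggregateMean g).ofLp
  set b : Fin K → ℝ := T *ᵥ (aggregateMean g').ofLp
  have hab : ∑ k, (a k - b k) ^ 2 ≤ (2 * C / D) ^ 2 / (N * σ ^ 2) := by
    have h1 := hT (aggregateMean g - aggregateMean g').ofLp
    rw [← EuclideanSpace.real_norm_sq_eq, WithLp.ofLp_sub, mulVec_sub] at h1
    refine h1.trans ?_
    gcongr
    exact norm_aggregateMean_sub_le hg hg' h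
  have he' : ∑ k, e k ^ 2 ≤ 2 * (C ^ 2 / (B * D)) ^ 2 / (N * σ ^ 2) ^ 2 := by
    refine he.trans ?_
    gcongr
    exact sum_sq_aggregateCov_sub_le B σ hg hg' h
  obtain ⟨hpos, hsum⟩ := sum_gaussianMomentExponent_le hα hc hm he' hab
  have hv (k : Fin K) : ((1 + e k).toNNReal : ℝ) = 1 + e k := Real.coe_toNNReal _ (hpos k).1.le
  have hP : aggregateLaw B σ g = (Measure.pi fun k => gaussianReal (a k) 1).map
      fun x => (WithLp.toLp 2 (R *ᵥ x) : EuclideanSpace ℝ (Fin K)) :=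
    aggregateLaw_eq_map_pi hB g (by rw [mulVec_mulVec, hRT, one_mulVec]) (by simpa using hS)
  have hQ : aggregateLaw B σ g' =
      (Measure.pi fun k => gaussianReal (b k) (1 + e k).toNNReal).map
        fun x => (WithLp.toLp 2 (R *ᵥ x) : EuclideanSpace ℝ (Fin K)) :=
    aggregateLaw_eq_map_pi hB g' (by rw [mulVec_mulVec, hRT, one_mulVec])
      (by simpa only [hv] using hS')
  have hemb : MeasurableEmbedding
      fun x => (WithLp.toLp 2 (R *ᵥ x) : EuclideanSpace ℝ (Fin K)) := by
    refine Continuous.measurableEmbedding (by fun_prop) fun x y hxy => ?_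
    have h1 : R *ᵥ x = R *ᵥ y := congrArg WithLp.ofLp hxy
    simpa [mulVec_mulVec, hTR] using congrArg (T *ᵥ ·) h1
  have hpi := pi_gaussianReal_absolutelyContinuous_and_lintegral (zero_le_one.trans hα.le) a b
    (v := fun k => (1 + e k).toNNReal) (fun k => (Real.toNNReal_pos.2 (hpos k).1).ne')
    (fun k => by rw [hv, add_sub_cancel_left]; exact (hpos k).2)
  rw [hP, hQ]
  refine ⟨hemb.absolutelyContinuous_map hpi.1, ?_⟩
  rw [lintegral_rnDeriv_map_rpow hemb, hpi.2]
  simp only [hv]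
  exact ENNReal.ofReal_le_ofReal (Real.exp_le_exp.2 hsum)

end Law

end SecureAgg

theorem theorem4 {𝒟 : Type*} {N D K : ℕ}
    (L : EuclideanSpace ℝ (Fin K) → 𝒟 → ℝ) (θ : EuclideanSpace ℝ (Fin K))
    (hL : ∀ d, DifferentiableAt ℝ (fun θ' => L θ' d) θ)
    (C B σ : ℝ) (hC : 0 < C) (hB : 1 ≤ B)
    (α : ℝ) (hα : α ∈ Set.Ioo 1 (N * σ ^ 2 * D / (2 * C ^ 2)))
    (ε : ℝ)
    (hε : ε = (2 * α * C ^ 2 / D ^ 2 + 2 * α * C ^ 2 / ((α - 1) * (B * D))) *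
      (1 / (N * σ ^ 2 - 2 * α * C ^ 2 / (B * D))))
    (i : Fin N) :
    SecureAgg.IsRDP (SecureAgg.AdjUser i)
        (SecureAgg.wfMechanism (N := N) (D := D) L θ C B σ) α ε ∧
      ∀ δ : ℝ, 0 < δ →
        SecureAgg.IsDP (SecureAgg.AdjUser i)
          (SecureAgg.wfMechanism (N := N) (D := D) L θ C B σ)
          (ε + Real.log (1 / δ) / (α - 1)) δ := by
  obtain ⟨hα1, hα2⟩ := hα
  have hα0 : 0 < α := by linarith
  -- For `D = 0` the interval of admissible `α` is empty.
  have hD : (0 : ℝ) < D := by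
    rcases (Nat.cast_nonneg D : (0 : ℝ) ≤ D).eq_or_lt with h | h
    · rw [← h, mul_zero, zero_div] at hα2
      linarith
    · exact h
  have hB0 : 0 < B := by linarith
  have hm : 0 < N * σ ^ 2 - 2 * α * (C ^ 2 / (B * D)) := by
    rw [lt_div_iff₀ (by positivity)] at hα2
    have h1 : C ^ 2 / (B * D) ≤ C ^ 2 / D :=
      div_le_div_of_nonneg_left (by positivity) hD (le_mul_of_one_le_left hD.le hB)
    have h2 : 2 * α * (C ^ 2 / D) < N * σ ^ 2 := by
      rw [← mul_div_assoc, div_lt_iff₀ hD]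
      linarith
    have h3 := mul_le_mul_of_nonneg_left h1 (by positivity : 0 ≤ 2 * α)
    linarith
  have key (X X' : Fin N → Fin D → 𝒟) (h : SecureAgg.AdjUser i X X') :
      SecureAgg.wfMechanism L θ C B σ X ≪ SecureAgg.wfMechanism L θ C B σ X' ∧
        ∫⁻ x, ((SecureAgg.wfMechanism L θ C B σ X).rnDeriv
          (SecureAgg.wfMechanism L θ C B σ X') x) ^ α ∂(SecureAgg.wfMechanism L θ C B σ X') ≤
          ENNReal.ofReal (Real.exp ((α - 1) * ε)) := by
    have hadj : SecureAgg.AdjUser i (fun k j => SecureAgg.clippedGrad L θ C (X k j))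
        (fun k j => SecureAgg.clippedGrad L θ C (X' k j)) := by
      obtain ⟨h1, j, h2⟩ := h
      exact ⟨fun k hk => by simp only [h1 k hk], j, fun l hl => by simp only [h2 l hl]⟩
    obtain ⟨hac, hle⟩ := SecureAgg.aggregateLaw_moment_le hB0.le hα1 hm
      (fun k j => SecureAgg.norm_clip_le hC _) (fun k j => SecureAgg.norm_clip_le hC _) hadj
    refine ⟨hac, hle.trans (ENNReal.ofReal_le_ofReal (Real.exp_le_exp.2 ?_))⟩
    have h1 : 0 < α - 1 := by linarith
    rw [hε, ← mul_assoc, mul_div_assoc (2 * α) (C ^ 2) (B * D)]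
    refine mul_le_mul_of_nonneg_right ?_ (one_div_pos.2 hm).le
    have h2 : (α - 1) * (2 * α * C ^ 2 / D ^ 2 + 2 * α * C ^ 2 / ((α - 1) * (B * D))) =
        α * (α - 1) * (2 * C / D) ^ 2 / 2 + 2 * (α * (C ^ 2 / (B * D))) := by
      field_simp
    have h3 : 0 ≤ α * (C ^ 2 / (B * D)) := by positivity
    rw [h2]
    linarith
  refine ⟨fun X X' h => SecureAgg.renyiDiv_le hα1 (key X X' h).1 (key X X' h).2,
    fun δ hδ X X' h S _ => ?_⟩
  have (X : Fin N → Fin D → 𝒟) : IsProbabilityMeasure (SecureAgg.wfMechanism L θ C B σ X) := by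
    rw [SecureAgg.wfMechanism]
    infer_instance
  exact SecureAgg.measure_le_of_lintegral_rnDeriv_rpow_le hα1 hδ (key X X' h).1 (key X X' h).2 S
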